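/- Let $n \ge 0$ and let $A = [a_{ij}] \in \mathbb{F}_2^{n\times n}$ be a strictly upper triangular matrix. Let $\Gamma$ be the group of affine transformations of $\mathbb{R}^n$ generated by $s_1,\dots,s_n$, where $$ s_i(x) = \operatorname{diag}\bigl((-1)^{a_{i1}},\dots,(-1)^{a_{in}}\bigr)\,x + \tfrac12 e_i \qquad (1\le i\le n) $$ and $e_1,\dots,e_n$ is the standard basis of $\mathbb{R}^n$; thus $\Gamma$ is the fundamental group of the real Bott manifold $M(A) = \mathbb{R}^n/\Gamma$. Let $\rho^{(2)}\colon H^2(\Gamma,\mathbb{Z}) \to H^2(\Gamma,\mathbb{F}_2)$ be the homomorphism of group cohomology (trivial coefficients) induced by reduction modulo $2$, and let $b_i = \operatorname{rk}_{\mathbb{Z}} H^i(\Gamma,\mathbb{Z})$ be the $i$-th Betti number of $M(A)$. Then $H^1(\Gamma,\mathbb{Z})$ and $H^2(\Gamma,\mathbb{Z})$ are finitely generated, the image of $\rho^{(2)}$ is finite-dimensional over $\mathbb{F}_2$, and $$ \dim_{\mathbb{F}_2} \operatorname{im} \rho^{(2)} = n - b_1 + b_2 . $$ -/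

import Mathlib

open CategoryTheory

noncomputable section

/-- The linear part `diag((-1)^{a_{i1}}, …, (-1)^{a_{in}})` of the `i`-th generator. -/
def bottLinear {n : ℕ} (A : Matrix (Fin n) (Fin n) (ZMod 2)) (i : Fin n) :
    (Fin n → ℝ) ≃ₗ[ℝ] (Fin n → ℝ) :=
  LinearEquiv.piCongrRight fun j =>
    if A i j = 1 then LinearEquiv.neg ℝ else LinearEquiv.refl ℝ ℝ

/-- The affine transformation `s_i` of `ℝⁿ`: the linear map `bottLinear A i` followed by the
translation by half of the `i`-th standard basis vector. -/
def bottGenerator {n : ℕ} (A : Matrix (Fin n) (Fin n) (ZMod 2)) (i : Fin n) :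
    (Fin n → ℝ) ≃ᵃ[ℝ] (Fin n → ℝ) :=
  AffineEquiv.constVAdd ℝ (Fin n → ℝ) (Pi.single i (1 / 2)) * (bottLinear A i).toAffineEquiv

theorem bottGenerator_apply {n : ℕ} (A : Matrix (Fin n) (Fin n) (ZMod 2)) (i : Fin n)
    (x : Fin n → ℝ) (j : Fin n) :
    bottGenerator A i x j =
      (if j = i then 1 / 2 else 0) + (if A i j = 1 then -(x j) else x j) := by
  by_cases h : A i j = 1 <;>
    simp [bottGenerator, bottLinear, AffineEquiv.mul_def, Pi.single_apply, h]

/-- The fundamental group `Γ` of the real Bott manifold `M(A) = ℝⁿ / Γ`, as the group of affine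
transformations of `ℝⁿ` generated by `s_1, …, s_n`. -/
def bottGroup {n : ℕ} (A : Matrix (Fin n) (Fin n) (ZMod 2)) :
    Subgroup ((Fin n → ℝ) ≃ᵃ[ℝ] (Fin n → ℝ)) :=
  Subgroup.closure (Set.range (bottGenerator A))

/-- `Hⁱ(G, ℤ)`, cohomology with trivial coefficients. -/
abbrev cohomZ (G : Type) [Group G] (i : ℕ) : ModuleCat ℤ :=
  groupCohomology (Rep.trivial ℤ G ℤ) i

/-- `Hⁱ(G, 𝔽₂)`, cohomology with trivial coefficients, as an abelian group. -/
abbrev cohomF2 (G : Type) [Group G] (i : ℕ) : ModuleCat ℤ :=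
  groupCohomology (Rep.trivial ℤ G (ZMod 2)) i

/-- The morphism of trivial `G`-modules `ρ : ℤ → 𝔽₂`, reduction modulo `2`. -/
def reductionMod2 (G : Type) [Group G] : Rep.trivial ℤ G ℤ ⟶ Rep.trivial ℤ G (ZMod 2) :=
  (Rep.trivialFunctor ℤ G).map (ModuleCat.ofHom (Int.castAddHom (ZMod 2)).toIntLinearMap)

/-- `ρ^{(i)} : Hⁱ(G, ℤ) → Hⁱ(G, 𝔽₂)`, the homomorphism induced by reduction modulo `2`. -/
def rhoMap (G : Type) [Group G] (i : ℕ) : cohomZ G i →+ cohomF2 G i :=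
  ((groupCohomology.functor ℤ G i).map (reductionMod2 G)).hom.toAddMonoidHom

theorem two_nsmul_cohomF2 (G : Type) [Group G] (i : ℕ) (x : cohomF2 G i) : 2 • x = 0 := by
  induction x using groupCohomology_induction_on with
  | h c =>
    have hc : 2 • c = 0 := by
      apply (ModuleCat.mono_iff_injective
        (groupCohomology.iCocycles (Rep.trivial ℤ G (ZMod 2)) i)).1 inferInstance
      rw [map_nsmul, map_zero]
      funext g
      exact CharTwo.two_nsmul (R := ZMod 2) _
    rw [← map_nsmul, hc, map_zero]

/-- The (unique) `𝔽₂`-vector space structure on the abelian group `Hⁱ(G, 𝔽₂)`. -/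
instance cohomF2Module (G : Type) [Group G] (i : ℕ) : Module (ZMod 2) (cohomF2 G i) :=
  AddCommGroup.zmodModule (two_nsmul_cohomF2 G i)

/-- The image of `ρ^{(i)}`, as an `𝔽₂`-subspace of `Hⁱ(G, 𝔽₂)`. -/
def rhoImage (G : Type) [Group G] (i : ℕ) : Submodule (ZMod 2) (cohomF2 G i) :=
  AddSubgroup.toZModSubmodule 2 (rhoMap G i).range

/-- The `i`-th Betti number `b_i = rk_ℤ Hⁱ(G, ℤ)`. -/
def bettiNumber (G : Type) [Group G] (i : ℕ) : ℕ :=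
  Module.finrank ℤ (cohomZ G i)

end

/-!
The argument has three ingredients.

*Counting.* The long exact sequence of `0 → ℤ → ℤ → 𝔽₂ → 0` identifies the image of `ρ⁽²⁾` with
`H²(Γ, ℤ) / 2`, and it shows that `H¹(Γ, 𝔽₂)` is an extension of the `2`-torsion of `H²(Γ, ℤ)` by
`H¹(Γ, ℤ) / 2`. A finitely generated abelian group `M` satisfies `|M / 2M| = 2 ^ rank M * |M[2]|`
(`natCard_quotient_two`), and `H¹(Γ, ℤ) = Hom(Γ, ℤ)` is torsion-free, so the sizes of these groups
give `|im ρ⁽²⁾| * 2 ^ b₁ = 2 ^ b₂ * |H¹(Γ, 𝔽₂)|` (`finrank_rhoImage_two`).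

*First cohomology.* `|H¹(Γ, 𝔽₂)| = |Hom(Γ, 𝔽₂)| = 2 ^ n`: a homomorphism is determined by its
values on the generators, and all values occur because, modulo `2`, twice the translation part of
an element of `Γ` does not see the signs in the linear parts (`natCard_bottGroup_hom`).

*Finite generation of `H²(Γ, ℤ)`.* The subgroups `⟨s_k, …, s_n⟩` form a poly-`ℤ` series: `s_k`
fixes or inverts the later generators under conjugation, and acts on the `k`-th coordinate by a
translation while the later generators act trivially on it. Hence it suffices to pass from the
kernel `N` of a split surjection `G → ℤ` to `G` (`finite_cohomZ_two_of_kernel_of_int`). By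
noetherianity only the kernel of the restriction `H²(G, ℤ) → H²(N, ℤ)` matters, and a class there
is controlled by how a lift of the generator of `ℤ` conjugates a lift of `N` in the corresponding
central extension (`exists_cobounding_of_kernel_of_int`).
-/

/-! ### Central extensions by `ℤ` and splitting over semidirect products with `ℤ` -/

/-- The underlying type of the central extension of `G` by `ℤ` attached to a function
`c : G → G → ℤ`; it is a group when `c` is a 2-cocycle (not assumed to be normalized). -/
@[ext]
structure CocycleExtension {G : Type} (c : G → G → ℤ) where
  /-- The image in `G`. -/
  base : G
  /-- The central coordinate. -/
  fibre : ℤ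

namespace CocycleExtension

variable {G : Type} [Group G] {c : G → G → ℤ}

instance : Mul (CocycleExtension c) :=
  ⟨fun x y => ⟨x.base * y.base, x.fibre + y.fibre + c x.base y.base⟩⟩

instance : One (CocycleExtension c) := ⟨⟨1, -c 1 1⟩⟩

instance : Inv (CocycleExtension c) :=
  ⟨fun x => ⟨x.base⁻¹, -x.fibre - c x.base⁻¹ x.base - c 1 1⟩⟩

@[simp] lemma mul_base (x y : CocycleExtension c) : (x * y).base = x.base * y.base := rfl

@[simp] lemma mul_fibre (x y : CocycleExtension c) :
    (x * y).fibre = x.fibre + y.fibre + c x.base y.base := rfl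

@[simp] lemma one_base : (1 : CocycleExtension c).base = 1 := rfl

@[simp] lemma one_fibre : (1 : CocycleExtension c).fibre = -c 1 1 := rfl

@[simp] lemma inv_base (x : CocycleExtension c) : x⁻¹.base = x.base⁻¹ := rfl

@[simp] lemma inv_fibre (x : CocycleExtension c) :
    x⁻¹.fibre = -x.fibre - c x.base⁻¹ x.base - c 1 1 := rfl

/-- The group structure on the extension defined by a 2-cocycle. -/
abbrev group (hc : ∀ g h j, c (g * h) j + c g h = c h j + c g (h * j)) :
    Group (CocycleExtension c) :=
  Group.ofLeftAxioms
    (fun x y z => by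
      ext
      · simp [mul_assoc]
      · have := hc x.base y.base z.base
        simp only [mul_fibre, mul_base]
        linarith)
    (fun x => by
      ext
      · simp
      · have := hc 1 1 x.base
        simp only [one_mul] at this
        simp only [mul_fibre, one_base, one_fibre]
        linarith)
    (fun x => by
      ext
      · simp
      · simp only [CocycleExtension.mul_fibre, CocycleExtension.inv_fibre,
          CocycleExtension.inv_base, CocycleExtension.one_fibre]
        ring)

end CocycleExtension

/-- Let `G` be generated by `N = ker χ` and `t`, where `χ : G → ℤ` maps `t` to `1`. A 2-cocycle
that vanishes on `N` and whose extension has `(t, 0)` acting by conjugation on the copy of `N` as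
`t` acts on `N` is a coboundary: the lifts of `N` and `t` generate a complement to the centre. -/
lemma exists_cobounding_of_kernel_of_int {G : Type} [Group G] (χ : G →* Multiplicative ℤ) (t : G)
    (ht : χ t = Multiplicative.ofAdd 1) (S : Set G) (hS : Subgroup.closure S = χ.ker)
    (c : G → G → ℤ) (hc : ∀ g h j, c (g * h) j + c g h = c h j + c g (h * j))
    (hN : ∀ a ∈ χ.ker, ∀ b ∈ χ.ker, c a b = 0)
    (hconj : ∀ s ∈ S, c t s = c (t * s * t⁻¹) t) :
    ∃ x : G → ℤ, ∀ g h, c g h = x h - x (g * h) + x g := by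
  let := CocycleExtension.group hc
  let π : CocycleExtension c →* G :=
    { toFun := CocycleExtension.base, map_one' := rfl, map_mul' := fun _ _ => rfl }
  have h11 : c 1 1 = 0 := hN 1 (one_mem _) 1 (one_mem _)
  let σ : χ.ker →* CocycleExtension c :=
    { toFun := fun a => ⟨a, 0⟩
      map_one' := by ext <;> simp [h11]
      map_mul' := fun a b => by
        ext
        · simp
        · simp [hN a a.2 b b.2] }
  let T : CocycleExtension c := ⟨t, 0⟩
  have hTσ : ∀ a : χ.ker, T * σ a * T⁻¹ = σ (MulAut.conjNormal t a) := by
    have hext : (MulAut.conj T).toMonoidHom.comp σ =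
        σ.comp (MulAut.conjNormal t).toMonoidHom := by
      have htop : Subgroup.closure (((↑) : χ.ker → G) ⁻¹' S) = ⊤ := by
        rw [← (Subgroup.map_injective χ.ker.subtype_injective).eq_iff, MonoidHom.map_closure,
          ← MonoidHom.range_eq_map, Subgroup.range_subtype, ← hS]
        congr 1
        ext s
        constructor
        · rintro ⟨s, hs, rfl⟩
          exact hs
        · exact fun hs => ⟨⟨s, hS ▸ Subgroup.subset_closure hs⟩, hs, rfl⟩
      apply MonoidHom.eq_of_eqOn_dense htop
      rintro ⟨s, hs'⟩ hs
      have hs : s ∈ S := hs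
      change T * (⟨s, 0⟩ : CocycleExtension c) * T⁻¹ = ⟨t * s * t⁻¹, 0⟩
      rw [mul_inv_eq_iff_eq_mul]
      ext
      · simp [T]
      · simpa [T] using hconj s hs
    intro a
    exact DFunLike.congr_fun hext a
  have hnorm : Subgroup.zpowers T ≤ Subgroup.normalizer (σ.range : Set (CocycleExtension c)) := by
    rw [Subgroup.zpowers_le, Subgroup.mem_normalizer_iff]
    intro e
    constructor
    · rintro ⟨a, rfl⟩
      exact ⟨_, (hTσ a).symm⟩
    · rintro ⟨m, hm⟩
      refine ⟨(MulAut.conjNormal t).symm m, ?_⟩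
      have := hTσ ((MulAut.conjNormal t).symm m)
      rw [MulEquiv.apply_symm_apply, hm] at this
      simpa using this
  let M : Subgroup (CocycleExtension c) := Subgroup.zpowers T ⊔ σ.range
  have hπσ : ∀ a : χ.ker, π (σ a) = a := fun _ => rfl
  have hπT : π T = t := rfl
  have hinj : ∀ m ∈ M, π m = 1 → m = 1 := by
    intro m hm h1
    rw [← SetLike.mem_coe, Subgroup.coe_mul_of_left_le_normalizer_right _ _ hnorm] at hm
    obtain ⟨_, ⟨k, rfl⟩, _, ⟨a, rfl⟩, rfl⟩ := hm
    simp only [map_mul, map_zpow, hπσ, hπT] at h1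
    have h2 := congrArg χ h1
    rw [map_mul, map_zpow, ht, MonoidHom.mem_ker.1 a.2, mul_one, ← ofAdd_zsmul] at h2
    have hk : k = 0 := by simpa using h2
    subst hk
    have ha : a = 1 := by
      ext
      simpa using h1
    simp [ha]
  have hsurj : ∀ g : G, ∃ m ∈ M, π m = g := by
    intro g
    have hmem : t ^ (-(χ g).toAdd) * g ∈ χ.ker := by
      rw [MonoidHom.mem_ker, map_mul, map_zpow, ht, ← ofAdd_zsmul]
      apply Multiplicative.toAdd.injective
      simp
    refine ⟨T ^ (χ g).toAdd * σ ⟨_, hmem⟩, mul_mem ?_ ?_, ?_⟩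
    · exact (le_sup_left : _ ≤ M) (Subgroup.zpow_mem_zpowers _ _)
    · exact (le_sup_right : _ ≤ M) ⟨_, rfl⟩
    · rw [map_mul, map_zpow, hπσ, hπT]
      simp
  choose τ hτM hτ using hsurj
  have hτmul : ∀ g h, τ (g * h) = τ g * τ h := by
    intro g h
    rw [← mul_inv_eq_one]
    refine hinj _ (mul_mem (hτM _) (inv_mem (mul_mem (hτM _) (hτM _)))) ?_
    simp [hτ]
  refine ⟨fun g => -(τ g).fibre, fun g h => ?_⟩
  have h1 := congrArg CocycleExtension.fibre (hτmul g h)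
  have h2 : (τ g).base = g := hτ g
  have h3 : (τ h).base = h := hτ h
  rw [CocycleExtension.mul_fibre, h2, h3] at h1
  linarith

/-! ### Finite generation of second cohomology -/

lemma LinearMap.isNoetherian_range_of_ker_le {R M X Y : Type*} [CommRing R] [IsNoetherianRing R]
    [AddCommGroup M] [Module R M] [AddCommGroup X] [Module R X] [AddCommGroup Y] [Module R Y]
    [Module.Finite R X] (φ : M →ₗ[R] X) (q : M →ₗ[R] Y) (h : φ.ker ≤ q.ker) :
    IsNoetherian R q.range := by
  have : Module.Finite R (M ⧸ φ.ker) := Module.Finite.equiv φ.quotKerEquivRange.symm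
  rw [← Submodule.range_liftQ φ.ker q h]
  infer_instance

/-- If `H` embeds in `G` as the kernel of a split surjection onto `ℤ`, then finite generation of
`H` and of `H²(H, ℤ)` implies finite generation of `H²(G, ℤ)`. The kernel of the restriction
`H²(G, ℤ) → H²(H, ℤ)` consists of classes of cocycles `z` vanishing on `H`, and such a class is
determined by the finitely many integers `z (t, s) - z (t s t⁻¹, t)`, for `s` among generators
of `H`. -/
theorem finite_cohomZ_two_of_kernel_of_int {G H : Type} [Group G] [Group H] (ι : H →* G)
    (hι : Function.Injective ι) (χ : G →* Multiplicative ℤ) (hχ : χ.ker = ι.range) (t : G)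
    (ht : χ t = Multiplicative.ofAdd 1) [Group.FG H] [Module.Finite ℤ (cohomZ H 2)] :
    Module.Finite ℤ (cohomZ G 2) := by
  obtain ⟨S, hS⟩ := Group.fg_def.1 ‹Group.FG H›
  let A := Rep.trivial ℤ G ℤ
  let B := Rep.trivial ℤ H ℤ
  let ψ : Rep.res ι A ⟶ B := 𝟙 B
  let r := (groupCohomology.map ι ψ 2).hom
  let q : groupCohomology.cocycles₂ A →ₗ[ℤ] cohomZ G 2 := (groupCohomology.H2π A).hom
  let K : Submodule ℤ (groupCohomology.cocycles₂ A) :=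
    { carrier := {z | ∀ a b, z.1 (ι a, ι b) = 0}
      zero_mem' := fun a b => rfl
      add_mem' := fun {x y} hx hy a b => by
        change x.1 (ι a, ι b) + y.1 (ι a, ι b) = 0
        rw [hx, hy]; rfl
      smul_mem' := fun m x hx a b => by
        change m • x.1 (ι a, ι b) = 0
        rw [hx, smul_zero] }
  let φ : K →ₗ[ℤ] (S → ℤ) :=
    { toFun := fun z s => (show ℤ from z.1.1 (t, ι s)) - (show ℤ from z.1.1 (t * ι s * t⁻¹, t))
      map_add' := fun x y => by
        funext s
        exact add_sub_add_comm _ _ _ _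
      map_smul' := fun m x => by
        funext s
        exact (mul_sub _ _ _).symm }
  have hφ : φ.ker ≤ (q ∘ₗ K.subtype).ker := by
    intro z hz
    have hz : φ z = 0 := hz
    change groupCohomology.H2π A z.1 = 0
    rw [groupCohomology.H2π_eq_zero_iff]
    have hcoc := (groupCohomology.mem_cocycles₂_iff _).1 z.1.2
    obtain ⟨x, hx⟩ := exists_cobounding_of_kernel_of_int χ t ht (ι '' S)
      (by rw [← MonoidHom.map_closure, hS, hχ, MonoidHom.range_eq_map])
      (fun g h => (show ℤ from z.1.1 (g, h))) hcoc
      (by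
        rw [hχ]
        rintro _ ⟨a, rfl⟩ _ ⟨b, rfl⟩
        exact z.2 a b)
      (by
        rintro _ ⟨s, hs, rfl⟩
        exact sub_eq_zero.1 (congrFun hz ⟨s, hs⟩))
    refine ⟨x, ?_⟩
    funext ⟨g, h⟩
    exact (hx g h).symm
  have hker : r.ker ≤ (q ∘ₗ K.subtype).range := by
    intro y hy
    induction y using groupCohomology.H2_induction_on with
    | h z =>
      have hy : (groupCohomology.H2π A ≫ groupCohomology.map ι ψ 2) z = 0 :=
        hy
      rw [groupCohomology.H2π_comp_map] at hy
      have hy : groupCohomology.H2π B (groupCohomology.mapCocycles₂ ι ψ z)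
        = 0 := hy
      rw [groupCohomology.H2π_eq_zero_iff] at hy
      obtain ⟨x, hx⟩ := hy
      let x' : H → ℤ := x
      have hx' : ∀ a b, x' b - x' (a * b) + x' a = (show ℤ from z.1 (ι a, ι b)) :=
        fun a b => congrFun hx (a, b)
      -- Subtracting the coboundary of an extension of `x` to `G` makes `z` vanish on `H`.
      let X : G → ℤ := Function.extend ι x' 0
      have hX : ∀ a, X (ι a) = x' a := fun a => hι.extend_apply _ _ _
      have hdX := groupCohomology.d₁₂_apply_mem_cocycles₂ (A := A) X
      let d : groupCohomology.cocycles₂ A := ⟨groupCohomology.d₁₂ A X, hdX⟩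
      refine ⟨⟨z - d, fun a b => ?_⟩, ?_⟩
      · change (show ℤ from z.1 (ι a, ι b)) - (X (ι b) - X (ι a * ι b) + X (ι a)) = 0
        rw [← map_mul, hX, hX, hX, hx', sub_self]
      · change groupCohomology.H2π A (z - d) = groupCohomology.H2π A z
        rw [map_sub, sub_eq_self, groupCohomology.H2π_eq_zero_iff]
        exact ⟨X, rfl⟩
  refine ⟨Submodule.fg_of_fg_map_of_fg_inf_ker r ?_ ?_⟩
  · rw [Submodule.map_top]
    exact IsNoetherian.noetherian _
  · rw [top_inf_eq]
    exact isNoetherian_submodule.1 (LinearMap.isNoetherian_range_of_ker_le φ _ hφ) _ hker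

/-! ### Counting modulo two -/

lemma natCard_quotient_two_of_finite (D : Type*) [AddCommGroup D] [Finite D] :
    Nat.card (D ⧸ (nsmulAddMonoidHom 2 : D →+ D).range) =
      Nat.card (nsmulAddMonoidHom 2 : D →+ D).ker := by
  set f : D →+ D := nsmulAddMonoidHom 2
  have h1 := f.range.card_eq_card_quotient_mul_card_addSubgroup
  have h2 := f.ker.card_eq_card_quotient_mul_card_addSubgroup
  rw [Nat.card_congr (QuotientAddGroup.quotientKerEquivRange f).toEquiv, h1, mul_comm] at h2
  exact Nat.eq_of_mul_eq_mul_left Nat.card_pos h2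

/-- A finitely generated abelian group is the product of a free group of the same rank and a
finite group. -/
lemma exists_equiv_free_prod_finite (M : Type*) [AddCommGroup M] [Module.Finite ℤ M] :
    ∃ (D : Type) (_ : AddCommGroup D) (_ : Finite D),
      Nonempty (M ≃ₗ[ℤ] (Fin (Module.finrank ℤ M) → ℤ) × D) := by
  have : AddGroup.FG M := Module.Finite.iff_addGroup_fg.1 inferInstance
  obtain ⟨n, ι, _, p, hp, m, ⟨f⟩⟩ := AddCommGroup.equiv_free_prod_directSum_zmod M
  have (i : ι) : NeZero (p i ^ m i) := ⟨pow_ne_zero _ (hp i).ne_zero⟩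
  let D := DirectSum ι fun i => ZMod (p i ^ m i)
  have : Finite D := Finite.of_equiv _ DFinsupp.equivFunOnFintype.symm
  let e : M ≃ₗ[ℤ] (Fin n → ℤ) × D :=
    f.toIntLinearEquiv ≪≫ₗ
      (Finsupp.linearEquivFunOnFinite ℤ ℤ (Fin n)).prodCongr (LinearEquiv.refl ℤ D)
  have hD : Module.finrank ℤ D = 0 := by
    rw [Module.finrank_eq_zero_iff_isTorsion]
    exact isAddTorsion_iff_isTorsion_int.1 isAddTorsion_of_finite
  have hrank := Submodule.finrank_quotient_add_finrank
    (LinearMap.fst ℤ (Fin n → ℤ) D).ker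
  rw [((LinearMap.fst ℤ (Fin n → ℤ) D).quotKerEquivOfSurjective Prod.fst_surjective).finrank_eq,
    LinearMap.ker_fst,
    (LinearEquiv.ofInjective (LinearMap.inr ℤ (Fin n → ℤ) D)
      LinearMap.inr_injective).symm.finrank_eq,
    hD, Module.finrank_fin_fun, add_zero, ← e.finrank_eq] at hrank
  exact ⟨D, inferInstance, inferInstance, hrank ▸ ⟨e⟩⟩

/-- For a finitely generated abelian group, `|M / 2M| = 2 ^ rank M * |M[2]|`. The `ℤ`-module
structure is arbitrary, since the one on group cohomology is not definitionally the canonical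
one. -/
lemma natCard_quotient_two (M : Type*) [AddCommGroup M] [inst : Module ℤ M] [Module.Finite ℤ M] :
    Finite (nsmulAddMonoidHom 2 : M →+ M).ker ∧
      Nat.card (M ⧸ (nsmulAddMonoidHom 2 : M →+ M).range) =
        2 ^ Module.finrank ℤ M * Nat.card (nsmulAddMonoidHom 2 : M →+ M).ker := by
  obtain rfl : inst = AddCommGroup.toIntModule M := Subsingleton.elim _ _
  obtain ⟨D, _, _, ⟨e⟩⟩ := exists_equiv_free_prod_finite M
  let r := Module.finrank ℤ M
  let red : (Fin r → ℤ) →+ (Fin r → ZMod 2) := (Int.castAddHom (ZMod 2)).compLeft (Fin r)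
  let α : M →+ (Fin r → ZMod 2) × (D ⧸ (nsmulAddMonoidHom 2 : D →+ D).range) :=
    (red.prodMap (QuotientAddGroup.mk' _)).comp e.toAddMonoidHom
  have hα : Function.Surjective α :=
    (Function.Surjective.prodMap (ZMod.intCast_surjective.comp_left)
      (QuotientAddGroup.mk'_surjective _)).comp e.surjective
  have hker : α.ker = (nsmulAddMonoidHom 2 : M →+ M).range := by
    ext x
    obtain ⟨⟨u, d⟩, rfl⟩ := e.symm.surjective x
    have hx : α (e.symm (u, d)) = (red u, QuotientAddGroup.mk d) := by simp [α]
    rw [AddMonoidHom.mem_ker, hx, Prod.mk_eq_zero, QuotientAddGroup.eq_zero_iff]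
    constructor
    · rintro ⟨hu, d', rfl⟩
      have hu' : ∀ i, ∃ v : ℤ, u i = 2 * v := fun i =>
        (ZMod.intCast_zmod_eq_zero_iff_dvd (u i) 2).1 (congrFun hu i)
      choose v hv using hu'
      refine ⟨e.symm (v, d'), ?_⟩
      rw [nsmulAddMonoidHom_apply, ← map_nsmul]
      congr 1
      ext i
      · simp [hv]
      · rfl
    · rintro ⟨y, hy⟩
      obtain ⟨⟨v, d'⟩, rfl⟩ := e.symm.surjective y
      rw [nsmulAddMonoidHom_apply, ← map_nsmul] at hy
      obtain ⟨rfl, rfl⟩ := Prod.mk.inj (e.symm.injective hy)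
      refine ⟨?_, d', rfl⟩
      funext i
      exact (ZMod.intCast_zmod_eq_zero_iff_dvd _ 2).2 ⟨v i, nsmul_eq_mul _ _⟩
  have hfix : ∀ x : M, 2 • x = 0 ↔ (e x).1 = 0 ∧ 2 • (e x).2 = 0 := by
    intro x
    rw [← e.map_eq_zero_iff, map_nsmul, Prod.ext_iff, Prod.smul_fst, Prod.smul_snd, Prod.fst_zero,
      Prod.snd_zero, smul_eq_zero_iff_right two_ne_zero]
  let ε : (nsmulAddMonoidHom 2 : M →+ M).ker ≃ (nsmulAddMonoidHom 2 : D →+ D).ker :=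
    { toFun := fun x => ⟨(e x.1).2, ((hfix x.1).1 x.2).2⟩
      invFun := fun d => ⟨e.symm (0, d.1), (hfix _).2 (by
        rw [e.apply_symm_apply]
        exact ⟨rfl, d.2⟩)⟩
      left_inv := fun x => by
        ext
        rw [LinearEquiv.symm_apply_eq]
        exact Prod.ext ((hfix x.1).1 x.2).1.symm rfl
      right_inv := fun d => by simp }
  refine ⟨Finite.of_equiv _ ε.symm, ?_⟩
  rw [← hker, Nat.card_congr (QuotientAddGroup.quotientKerEquivOfSurjective α hα).toEquiv,
    Nat.card_prod, natCard_quotient_two_of_finite, Nat.card_congr ε]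
  simp [r]

/-! ### The Bockstein sequence of `0 → ℤ → ℤ → 𝔽₂ → 0` -/

lemma Rep.exact_of_forall {k G : Type} [CommRing k] [Group G] (X : ShortComplex (Rep.{0} k G))
    (h : ∀ x : X.X₂, X.g.hom x = 0 → ∃ y : X.X₁, X.f.hom y = x) : X.Exact :=
  (forget₂ (Rep.{0} k G) (ModuleCat.{0} k)).reflects_exact_of_faithful _ <|
    (ShortComplex.moduleCat_exact_iff _).2 h

section

open groupCohomology

variable (G : Type) [Group G]

/-- Multiplication by `2` on the trivial `G`-module `ℤ`. -/
noncomputable def doubling : Rep.trivial ℤ G ℤ ⟶ Rep.trivial ℤ G ℤ := 𝟙 _ + 𝟙 _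

lemma doubling_hom_apply (x : ℤ) : (doubling G).hom x = 2 * x := (two_mul x).symm

lemma doubling_comp_reductionMod2 : (doubling G ≫ reductionMod2 G) = 0 := by
  ext1
  ext1
  apply LinearMap.ext
  intro (x : ℤ)
  change ((x + x : ℤ) : ZMod 2) = 0
  push_cast
  exact CharTwo.add_self_eq_zero _

lemma bockstein_shortExact : (ShortComplex.mk _ _ (doubling_comp_reductionMod2 G)).ShortExact where
  exact := by
    refine Rep.exact_of_forall _ ?_
    intro (x : ℤ) hx
    have hx : ((x : ℤ) : ZMod 2) = 0 := hx
    obtain ⟨y, rfl⟩ := (ZMod.intCast_zmod_eq_zero_iff_dvd x 2).1 hx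
    exact ⟨(y : ℤ), doubling_hom_apply G y⟩
  mono_f := by
    rw [Rep.mono_iff_injective]
    intro (x : ℤ) (y : ℤ) hxy
    have hxy : x + x = y + y := hxy
    have : x = y := by lia
    exact this
  epi_g := by
    rw [Rep.epi_iff_surjective]
    change Function.Surjective (Int.cast : ℤ → ZMod 2)
    exact ZMod.intCast_surjective

lemma functor_map_doubling (i : ℕ) (x : cohomZ G i) :
    (groupCohomology.functor ℤ G i).map (doubling G) x = 2 • x := by
  have : (groupCohomology.functor ℤ G i).map (doubling G) = 𝟙 _ + 𝟙 _ := by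
    change HomologicalComplex.homologyMap ((cochainsFunctor ℤ G).map (doubling G)) i = _
    rw [doubling, Functor.map_add, HomologicalComplex.homologyMap_add,
      CategoryTheory.Functor.map_id, HomologicalComplex.homologyMap_id]
    rfl
  rw [this]
  change x + x = _
  exact (two_nsmul x).symm

/-- The Bockstein homomorphism `H¹(G, 𝔽₂) → H²(G, ℤ)`. -/
noncomputable abbrev bockstein : cohomF2 G 1 ⟶ cohomZ G 2 := δ (bockstein_shortExact G) 1 2 rfl

lemma bockstein_eq_zero_iff (y : cohomF2 G 1) : bockstein G y = 0 ↔ y ∈ (rhoMap G 1).range := by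
  constructor
  · exact fun h => (ShortComplex.moduleCat_exact_iff _).1
      (mapShortComplex₃_exact (bockstein_shortExact G) (rfl : 1 + 1 = 2)) y h
  · rintro ⟨x, rfl⟩
    exact ConcreteCategory.congr_hom
      (mapShortComplex₃ (bockstein_shortExact G) (rfl : 1 + 1 = 2)).zero x

lemma rhoMap_eq_zero_iff (i : ℕ) (y : cohomZ G i) :
    rhoMap G i y = 0 ↔ ∃ x : cohomZ G i, 2 • x = y := by
  constructor
  · intro h
    obtain ⟨x, hx⟩ := (ShortComplex.moduleCat_exact_iff _).1
      (mapShortComplex₂_exact (bockstein_shortExact G) i) y h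
    exact ⟨x, (functor_map_doubling G i x).symm.trans hx⟩
  · rintro ⟨x, rfl⟩
    exact (congrArg (rhoMap G i) (functor_map_doubling G i x)).symm.trans <|
      ConcreteCategory.congr_hom
        (mapShortComplex₂ (ShortComplex.mk _ _ (doubling_comp_reductionMod2 G)) i).zero x

lemma two_smul_eq_zero_iff (y : cohomZ G 2) : 2 • y = 0 ↔ ∃ x : cohomF2 G 1, bockstein G x = y := by
  constructor
  · exact fun h => (ShortComplex.moduleCat_exact_iff _).1
      (mapShortComplex₁_exact (bockstein_shortExact G) (rfl : 1 + 1 = 2)) y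
      ((functor_map_doubling G 2 y).trans h)
  · rintro ⟨x, rfl⟩
    exact (functor_map_doubling G 2 _).symm.trans <|
      ConcreteCategory.congr_hom
        (mapShortComplex₁ (bockstein_shortExact G) (rfl : 1 + 1 = 2)).zero x

lemma natCard_rhoMap_range (i : ℕ) [Module.Finite ℤ (cohomZ G i)] :
    Nat.card (rhoMap G i).range = 2 ^ bettiNumber G i *
      Nat.card (nsmulAddMonoidHom 2 : cohomZ G i →+ cohomZ G i).ker ∧ Finite (rhoMap G i).range := by
  obtain ⟨hfin, hcard⟩ := natCard_quotient_two (cohomZ G i)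
  have hker : (rhoMap G i).ker = (nsmulAddMonoidHom 2 : cohomZ G i →+ cohomZ G i).range := by
    ext y
    exact rhoMap_eq_zero_iff G i y
  have e := (QuotientAddGroup.quotientAddEquivOfEq hker).symm.trans
    (QuotientAddGroup.quotientKerEquivRange (rhoMap G i))
  have h : Nat.card (rhoMap G i).range = 2 ^ bettiNumber G i *
      Nat.card (nsmulAddMonoidHom 2 : cohomZ G i →+ cohomZ G i).ker :=
    (Nat.card_congr e.toEquiv).symm.trans hcard
  refine ⟨h, Nat.finite_of_card_ne_zero ?_⟩
  rw [h]
  exact mul_ne_zero (by positivity) Nat.card_pos.ne'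

lemma natCard_cohomF2_one [Module.Finite ℤ (cohomZ G 1)]
    (htf : ∀ x : cohomZ G 1, 2 • x = 0 → x = 0) :
    Nat.card (cohomF2 G 1) =
      2 ^ bettiNumber G 1 * Nat.card (nsmulAddMonoidHom 2 : cohomZ G 2 →+ cohomZ G 2).ker := by
  let β : cohomF2 G 1 →+ cohomZ G 2 := (bockstein G).hom.toAddMonoidHom
  have hker : β.ker = (rhoMap G 1).range := by
    ext y
    exact bockstein_eq_zero_iff G y
  have hrange : β.range = (nsmulAddMonoidHom 2 : cohomZ G 2 →+ cohomZ G 2).ker := by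
    ext y
    exact (two_smul_eq_zero_iff G y).symm
  have hbot : (nsmulAddMonoidHom 2 : cohomZ G 1 →+ cohomZ G 1).ker = ⊥ :=
    (AddSubgroup.eq_bot_iff_forall _).2 fun x hx => htf x hx
  rw [AddSubgroup.card_eq_card_quotient_mul_card_addSubgroup β.ker,
    Nat.card_congr (QuotientAddGroup.quotientKerEquivRange β).toEquiv, hker, hrange,
    (natCard_rhoMap_range G 1).1, hbot, AddSubgroup.card_bot, mul_one, mul_comm]

/-- The dimension count: the image of `ρ⁽²⁾` is `H²(G, ℤ) / 2`, the kernel of the Bockstein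
homomorphism is `H¹(G, ℤ) / 2`, and its image is the `2`-torsion of `H²(G, ℤ)`. -/
theorem finrank_rhoImage_two [Module.Finite ℤ (cohomZ G 1)] [Module.Finite ℤ (cohomZ G 2)]
    (htf : ∀ x : cohomZ G 1, 2 • x = 0 → x = 0) {n : ℕ}
    (hn : Nat.card (cohomF2 G 1) = 2 ^ n) :
    Module.Finite (ZMod 2) (rhoImage G 2) ∧
    (Module.finrank (ZMod 2) (rhoImage G 2) : ℤ) =
      (n : ℤ) - (bettiNumber G 1 : ℤ) + (bettiNumber G 2 : ℤ) := by
  obtain ⟨hcard, hfin⟩ := natCard_rhoMap_range G 2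
  have hfin' : Finite (rhoImage G 2) := hfin
  have hcard' : Nat.card (rhoImage G 2) = 2 ^ bettiNumber G 2 *
    Nat.card (nsmulAddMonoidHom 2 : cohomZ G 2 →+ cohomZ G 2).ker := hcard
  refine ⟨inferInstance, ?_⟩
  have h1 := natCard_cohomF2_one G htf
  rw [hn] at h1
  rw [Module.natCard_eq_pow_finrank (K := ZMod 2), Nat.card_zmod] at hcard'
  have h2 : 2 ^ (Module.finrank (ZMod 2) (rhoImage G 2) + bettiNumber G 1) =
      2 ^ (n + bettiNumber G 2) := by
    rw [pow_add, pow_add, hcard', h1]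
    ring
  have h3 := Nat.pow_right_injective le_rfl h2
  lia

/-! ### First cohomology with trivial coefficients -/

lemma finite_cohomZ_one [Group.FG G] : Module.Finite ℤ (cohomZ G 1) := by
  obtain ⟨S, hS⟩ := Group.fg_def.1 ‹Group.FG G›
  let ev : (Additive G →+ ℤ) →ₗ[ℤ] (S → ℤ) :=
    { toFun := fun f s => f (Additive.ofMul s)
      map_add' := fun _ _ => rfl
      map_smul' := fun _ _ => rfl }
  have hev : Function.Injective ev := fun f g h => by
    apply AddMonoidHom.toMultiplicativeRight.injective
    exact MonoidHom.eq_of_eqOn_dense hS fun s hs => congrFun h ⟨s, hs⟩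
  have : Module.Finite ℤ (Additive G →+ ℤ) := Module.Finite.of_injective ev hev
  exact Module.Finite.equiv (H1IsoOfIsTrivial (Rep.trivial ℤ G ℤ)).toLinearEquiv.symm

lemma cohomZ_one_eq_zero_of_two_smul (x : cohomZ G 1) (hx : 2 • x = 0) : x = 0 := by
  let e := (H1IsoOfIsTrivial (Rep.trivial ℤ G ℤ)).toLinearEquiv
  have h : 2 • e x = 0 := by
    rw [← map_nsmul, hx, map_zero]
  apply e.injective
  rw [map_zero]
  refine AddMonoidHom.ext fun g => ?_
  have h2 : 2 • (show ℤ from e x g) = 0 := DFunLike.congr_fun h g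
  exact (smul_eq_zero_iff_right two_ne_zero).1 h2

lemma natCard_cohomF2_one_eq_hom :
    Nat.card (cohomF2 G 1) = Nat.card (Additive G →+ ZMod 2) :=
  Nat.card_congr (H1IsoOfIsTrivial (Rep.trivial ℤ G (ZMod 2))).toLinearEquiv.toEquiv

lemma finite_cohomZ_two_of_subsingleton [Subsingleton G] : Module.Finite ℤ (cohomZ G 2) := by
  have := ModuleCat.subsingleton_of_isZero
    (isZero_groupCohomology_succ_of_subsingleton (Rep.trivial ℤ G ℤ) 1)
  infer_instance

end

/-! ### The structure of the Bott group -/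

section

variable {n : ℕ} (A : Matrix (Fin n) (Fin n) (ZMod 2))

/-- The subgroup of the Bott group generated by the `s_i` with `k ≤ i`. -/
def bottTail (k : ℕ) : Subgroup ((Fin n → ℝ) ≃ᵃ[ℝ] (Fin n → ℝ)) :=
  Subgroup.closure (bottGenerator A '' {i | k ≤ (i : ℕ)})

lemma bottTail_zero : bottTail A 0 = bottGroup A := by
  simp [bottTail, bottGroup]

lemma bottGenerator_mem_bottTail {k : ℕ} {i : Fin n} (h : k ≤ i) :
    bottGenerator A i ∈ bottTail A k :=
  Subgroup.subset_closure ⟨i, h, rfl⟩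

lemma bottTail_succ_le (k : ℕ) : bottTail A (k + 1) ≤ bottTail A k :=
  Subgroup.closure_mono (Set.image_mono fun _ h => (Nat.le_succ k).trans h)

lemma bottTail_eq_bot {k : ℕ} (h : n ≤ k) : bottTail A k = ⊥ := by
  have : {i : Fin n | k ≤ (i : ℕ)} = ∅ := by
    ext i
    simpa using i.2.trans_le h
  rw [bottTail, this, Set.image_empty, Subgroup.closure_empty]

instance (k : ℕ) : Group.FG (bottTail A k) :=
  (Group.fg_iff_subgroup_fg _).2
    ((Subgroup.fg_iff _).2 ⟨_, rfl, (Set.toFinite _).image _⟩)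

/-- Twice the `j`-th coordinate of the translation part. On the Bott group this number is an
integer, so that no information is lost in taking the floor. -/
noncomputable def halfTranslation (j : Fin n) (g : (Fin n → ℝ) ≃ᵃ[ℝ] (Fin n → ℝ)) : ℤ :=
  ⌊2 * g 0 j⌋

lemma halfTranslation_eq {j : Fin n} {g : (Fin n → ℝ) ≃ᵃ[ℝ] (Fin n → ℝ)} {e v : ℤ}
    (h : ∀ x, g x j = e * x j + v / 2) : halfTranslation j g = v := by
  rw [halfTranslation, h, Pi.zero_apply, mul_zero, zero_add, mul_div_cancel₀ _ two_ne_zero,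
    Int.floor_intCast]

/-- The elements of the Bott group act on each coordinate by `x ↦ ± x + v / 2`, with `v` an
integer. -/
lemma bottGroup_apply {g : (Fin n → ℝ) ≃ᵃ[ℝ] (Fin n → ℝ)} (hg : g ∈ bottGroup A) (j : Fin n) :
    ∃ e : ℤ, (e = 1 ∨ e = -1) ∧ ∀ x, g x j = e * x j + halfTranslation j g / 2 := by
  suffices h : ∃ e v : ℤ, (e = 1 ∨ e = -1) ∧ ∀ x, g x j = e * x j + v / 2 by
    obtain ⟨e, v, he, h⟩ := h
    exact ⟨e, he, by rwa [halfTranslation_eq h]⟩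
  induction hg using Subgroup.closure_induction with
  | mem g hg =>
    obtain ⟨i, rfl⟩ := hg
    refine ⟨if A i j = 1 then -1 else 1, if j = i then 1 else 0, by split_ifs <;> simp,
      fun x => ?_⟩
    rw [bottGenerator_apply]
    split_ifs <;> push_cast <;> ring
  | one => exact ⟨1, 0, by simp, fun x => by simp⟩
  | mul g h _ _ hg hh =>
    obtain ⟨e, v, he, hg⟩ := hg
    obtain ⟨e', v', he', hh⟩ := hh
    refine ⟨e * e', e * v' + v, ?_, fun x => ?_⟩
    · rcases he with rfl | rfl <;> rcases he' with rfl | rfl <;> simp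
    · rw [AffineEquiv.coe_mul, Function.comp_apply, hg, hh]
      push_cast
      ring
  | inv g _ hg =>
    obtain ⟨e, v, he, hg⟩ := hg
    refine ⟨e, -(e * v), he, fun x => ?_⟩
    have h := hg (g⁻¹ x)
    rw [← Function.comp_apply (f := g), ← AffineEquiv.coe_mul, mul_inv_cancel, AffineEquiv.coe_one,
      id] at h
    rw [h]
    rcases he with rfl | rfl <;> push_cast <;> ring

lemma halfTranslation_bottGenerator (i j : Fin n) :
    halfTranslation j (bottGenerator A i) = if j = i then 1 else 0 := by
  refine halfTranslation_eq (e := if A i j = 1 then -1 else 1) fun x => ?_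
  rw [bottGenerator_apply]
  split_ifs <;> push_cast <;> ring

/-- Modulo `2` the signs in the linear part disappear, so the doubled translation part becomes a
homomorphism. -/
lemma halfTranslation_mul_mod_two {g h : (Fin n → ℝ) ≃ᵃ[ℝ] (Fin n → ℝ)} (hg : g ∈ bottGroup A)
    (hh : h ∈ bottGroup A) (j : Fin n) :
    (halfTranslation j (g * h) : ZMod 2) = halfTranslation j g + halfTranslation j h := by
  obtain ⟨e, he, hg⟩ := bottGroup_apply A hg j
  obtain ⟨e', -, hh⟩ := bottGroup_apply A hh j
  have : halfTranslation j (g * h) = e * halfTranslation j h + halfTranslation j g := by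
    refine halfTranslation_eq (e := e * e') fun x => ?_
    rw [AffineEquiv.coe_mul, Function.comp_apply, hg, hh]
    push_cast
    ring
  rw [this]
  rcases he with rfl | rfl
  · push_cast
    ring
  · push_cast
    rw [neg_one_mul, ZMod.neg_eq_self_mod_two, add_comm]

/-- Homomorphisms from the Bott group to `𝔽₂` are determined by their values on the generators,
which can be prescribed. -/
lemma natCard_bottGroup_hom :
    Nat.card (Additive (bottGroup A) →+ ZMod 2) = 2 ^ n := by
  let s : Fin n → bottGroup A := fun i => ⟨bottGenerator A i, Subgroup.subset_closure ⟨i, rfl⟩⟩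
  let ev : (Additive (bottGroup A) →+ ZMod 2) → (Fin n → ZMod 2) :=
    fun f i => f (Additive.ofMul (s i))
  have hinj : Function.Injective ev := fun f g h => by
    apply AddMonoidHom.toMultiplicativeRight.injective
    refine MonoidHom.eq_of_eqOn_dense (Subgroup.closure_closure_coe_preimage (k :=
      Set.range (bottGenerator A))) ?_
    rintro ⟨_, hs⟩ ⟨i, rfl⟩
    exact congrFun h i
  have hsurj : Function.Surjective ev := fun w => by
    refine ⟨AddMonoidHom.mk' (fun g => ∑ j, w j * halfTranslation j g.toMul.1) ?_, ?_⟩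
    · intro g h
      simp only [toMul_add, Subgroup.coe_mul,
        halfTranslation_mul_mod_two A g.toMul.2 h.toMul.2, mul_add, Finset.sum_add_distrib]
    · funext i
      simp [ev, s, halfTranslation_bottGenerator]
  rw [Nat.card_congr (Equiv.ofBijective ev ⟨hinj, hsurj⟩)]
  simp

variable {A}

/-- Conjugation by `s_k` fixes or inverts the later generators. -/
lemma bottGenerator_conj (hA : ∀ i j : Fin n, j ≤ i → A i j = 0) {k i : Fin n} (hki : k < i) :
    bottGenerator A k * bottGenerator A i = bottGenerator A i * bottGenerator A k ∨
      bottGenerator A k * bottGenerator A i = (bottGenerator A i)⁻¹ * bottGenerator A k := by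
  have hik := hA i k hki.le
  have hii := hA i i le_rfl
  have hkk := hA k k le_rfl
  by_cases h : A k i = 1
  · right
    rw [eq_inv_mul_iff_mul_eq]
    ext x j
    simp only [AffineEquiv.coe_mul, Function.comp_apply, bottGenerator_apply]
    by_cases hji : j = i
    · subst hji
      simp [h, hii, hki.ne']
    · by_cases hjk : j = k
      · subst hjk
        simp [hik, hkk, hji]
      · simp only [hji, hjk, if_false, zero_add]
        split_ifs <;> simp
  · left
    ext x j
    simp only [AffineEquiv.coe_mul, Function.comp_apply, bottGenerator_apply]
    by_cases hji : j = i
    · subst hji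
      simp [h, hii, hki.ne']
    · by_cases hjk : j = k
      · subst hjk
        simp [hik, hkk, hji]
      · simp only [hji, hjk, if_false, zero_add]
        split_ifs <;> simp

lemma zpowers_bottGenerator_le_normalizer (hA : ∀ i j : Fin n, j ≤ i → A i j = 0) (k : Fin n) :
    Subgroup.zpowers (bottGenerator A k) ≤
      Subgroup.normalizer (bottTail A (k + 1) : Set ((Fin n → ℝ) ≃ᵃ[ℝ] (Fin n → ℝ))) := by
  set t := bottGenerator A k
  rw [Subgroup.zpowers_le, Subgroup.mem_normalizer_iff]
  have hgen : ∀ i : Fin n, (k : ℕ) + 1 ≤ i → t * bottGenerator A i * t⁻¹ ∈ bottTail A (k + 1) ∧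
      t⁻¹ * bottGenerator A i * t ∈ bottTail A (k + 1) := by
    intro i hi
    have hmem := bottGenerator_mem_bottTail A hi
    rcases bottGenerator_conj hA (show k < i from hi) with h | h
    · constructor
      · rwa [h, mul_inv_cancel_right]
      · rwa [mul_assoc, ← h, inv_mul_cancel_left]
    · constructor
      · rw [h, mul_inv_cancel_right]
        exact inv_mem hmem
      · have h' : t⁻¹ * bottGenerator A i * t = (bottGenerator A i)⁻¹ := by
          rw [mul_assoc, inv_mul_eq_iff_eq_mul, eq_mul_inv_iff_mul_eq, mul_assoc, h,
            mul_inv_cancel_left]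
        rw [h']
        exact inv_mem hmem
  have h1 : ∀ h ∈ bottTail A (k + 1), t * h * t⁻¹ ∈ bottTail A (k + 1) := by
    intro h hh
    have : bottTail A (k + 1) ≤ (bottTail A (k + 1)).comap (MulAut.conj t).toMonoidHom := by
      rw [bottTail, Subgroup.closure_le]
      rintro _ ⟨i, hi, rfl⟩
      exact (hgen i hi).1
    exact this hh
  have h2 : ∀ h ∈ bottTail A (k + 1), t⁻¹ * h * t ∈ bottTail A (k + 1) := by
    intro h hh
    have : bottTail A (k + 1) ≤ (bottTail A (k + 1)).comap (MulAut.conj t⁻¹).toMonoidHom := by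
      rw [bottTail, Subgroup.closure_le]
      rintro _ ⟨i, hi, rfl⟩
      change t⁻¹ * bottGenerator A i * t⁻¹⁻¹ ∈ bottTail A (k + 1)
      rw [inv_inv]
      exact (hgen i hi).2
    simpa using this hh
  refine fun h => ⟨h1 h, fun hh => ?_⟩
  simpa [mul_assoc] using h2 _ hh

lemma bottTail_eq_sup (k : Fin n) :
    bottTail A k = Subgroup.zpowers (bottGenerator A k) ⊔ bottTail A (k + 1) := by
  have : {i : Fin n | (k : ℕ) ≤ i} = {k} ∪ {i : Fin n | (k : ℕ) + 1 ≤ i} := by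
    ext i
    simp only [Set.mem_ofPred_eq, Set.mem_union, Set.mem_singleton_iff, Fin.ext_iff]
    lia
  rw [bottTail, this, Set.image_union, Subgroup.closure_union, Set.image_singleton,
    Subgroup.zpowers_eq_closure, bottTail]

lemma bottTail_apply (hA : ∀ i j : Fin n, j ≤ i → A i j = 0) (k : Fin n)
    {g : (Fin n → ℝ) ≃ᵃ[ℝ] (Fin n → ℝ)} (hg : g ∈ bottTail A k) (x : Fin n → ℝ) :
    g x k = x k + halfTranslation k g / 2 := by
  suffices h : ∃ v : ℤ, ∀ x, g x k = x k + v / 2 by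
    obtain ⟨v, h⟩ := h
    rw [h, halfTranslation_eq (e := 1) (v := v) (fun x => by simp [h])]
  induction hg using Subgroup.closure_induction with
  | mem g hg =>
    obtain ⟨i, hi, rfl⟩ := hg
    refine ⟨if k = i then 1 else 0, fun x => ?_⟩
    rw [bottGenerator_apply, hA i k hi]
    split_ifs <;> simp_all [add_comm]
  | one => exact ⟨0, fun x => by simp⟩
  | mul g h _ _ hg hh =>
    obtain ⟨v, hg⟩ := hg
    obtain ⟨v', hh⟩ := hh
    refine ⟨v' + v, fun x => ?_⟩
    rw [AffineEquiv.coe_mul, Function.comp_apply, hg, hh]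
    push_cast
    ring
  | inv g _ hg =>
    obtain ⟨v, hg⟩ := hg
    refine ⟨-v, fun x => ?_⟩
    have h := hg (g⁻¹ x)
    rw [← Function.comp_apply (f := g), ← AffineEquiv.coe_mul, mul_inv_cancel, AffineEquiv.coe_one,
      id] at h
    rw [h]
    push_cast
    ring

/-- The homomorphism from `⟨s_k, s_{k+1}, …⟩` to `ℤ` sending `s_k` to `1` and the later generators
to `0`: these elements act on the `k`-th coordinate by translations. -/
noncomputable def bottTailTranslation (hA : ∀ i j : Fin n, j ≤ i → A i j = 0) (k : Fin n) :
    bottTail A k →* Multiplicative ℤ :=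
  MonoidHom.mk' (fun g => Multiplicative.ofAdd (halfTranslation k g.1)) fun g h => by
    rw [← ofAdd_add]
    congr 1
    refine halfTranslation_eq (e := 1) fun x => ?_
    rw [Subgroup.coe_mul, AffineEquiv.coe_mul, Function.comp_apply, bottTail_apply hA k g.2,
      bottTail_apply hA k h.2]
    push_cast
    ring

lemma bottTailTranslation_generator (hA : ∀ i j : Fin n, j ≤ i → A i j = 0) (k : Fin n) :
    bottTailTranslation hA k ⟨bottGenerator A k, bottGenerator_mem_bottTail A le_rfl⟩ =
      Multiplicative.ofAdd 1 := by
  simp [bottTailTranslation, halfTranslation_bottGenerator]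

lemma bottTailTranslation_ker (hA : ∀ i j : Fin n, j ≤ i → A i j = 0) (k : Fin n) :
    (bottTailTranslation hA k).ker = (Subgroup.inclusion (bottTail_succ_le A k)).range := by
  have hle : ∀ g (hg : g ∈ bottTail A (k + 1)),
      bottTailTranslation hA k ⟨g, bottTail_succ_le A k hg⟩ = 1 := by
    intro g hg
    induction hg using Subgroup.closure_induction with
    | mem g hg =>
      obtain ⟨i, hi, rfl⟩ := hg
      have : k ≠ i := fun h => by
        subst h
        exact absurd hi (Nat.not_succ_le_self _)
      simp [bottTailTranslation, halfTranslation_bottGenerator, this]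
    | one => exact map_one _
    | mul g h hg' hh' hg hh =>
      exact (map_mul _ (⟨g, bottTail_succ_le A k hg'⟩ : bottTail A k)
        ⟨h, bottTail_succ_le A k hh'⟩).trans (by rw [hg, hh, mul_one])
    | inv g hg' hg =>
      exact (map_inv _ (⟨g, bottTail_succ_le A k hg'⟩ : bottTail A k)).trans (by rw [hg, inv_one])
  apply le_antisymm
  · rintro ⟨g, hg⟩ h
    have hg' := hg
    rw [bottTail_eq_sup, ← SetLike.mem_coe, Subgroup.coe_mul_of_left_le_normalizer_right _ _
      (zpowers_bottGenerator_le_normalizer hA k)] at hg'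
    obtain ⟨_, ⟨m, rfl⟩, a, ha, rfl⟩ := hg'
    let t : bottTail A k := ⟨bottGenerator A k, bottGenerator_mem_bottTail A le_rfl⟩
    have h' : bottTailTranslation hA k (t ^ m * ⟨a, bottTail_succ_le A k ha⟩) = 1 := h
    rw [map_mul, map_zpow, hle a ha, bottTailTranslation_generator, mul_one, ← ofAdd_zsmul] at h'
    have hm : m = 0 := by simpa using h'
    subst hm
    refine ⟨⟨a, ha⟩, ?_⟩
    ext1
    simp
  · rintro _ ⟨g, rfl⟩
    exact hle g.1 g.2

/-- The Bott group is poly-`ℤ` with terms `⟨s_k, …⟩`, along which finite generation of `H²`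
ascends. -/
lemma finite_cohomZ_two_bottTail (hA : ∀ i j : Fin n, j ≤ i → A i j = 0) (m : ℕ) :
    ∀ k, n ≤ k + m → Module.Finite ℤ (cohomZ (bottTail A k) 2) := by
  induction m with
  | zero =>
    intro k hk
    have : Subsingleton (bottTail A k) := by
      rw [bottTail_eq_bot A (k := k) hk]
      infer_instance
    exact finite_cohomZ_two_of_subsingleton _
  | succ m ih =>
    intro k hk
    have := ih (k + 1) (by lia)
    by_cases hkn : k < n
    · exact finite_cohomZ_two_of_kernel_of_int (Subgroup.inclusion (bottTail_succ_le A k))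
        (Subgroup.inclusion_injective _) (bottTailTranslation hA ⟨k, hkn⟩)
        (bottTailTranslation_ker hA ⟨k, hkn⟩) _ (bottTailTranslation_generator hA ⟨k, hkn⟩)
    · exact ih k (by lia)

end

theorem lemma3p4 {n : ℕ} (A : Matrix (Fin n) (Fin n) (ZMod 2))
    (hA : ∀ i j : Fin n, j ≤ i → A i j = 0) :
    Module.Finite ℤ (cohomZ (bottGroup A) 1) ∧
    Module.Finite ℤ (cohomZ (bottGroup A) 2) ∧
    Module.Finite (ZMod 2) (rhoImage (bottGroup A) 2) ∧
    (Module.finrank (ZMod 2) (rhoImage (bottGroup A) 2) : ℤ) =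
      (n : ℤ) - (bettiNumber (bottGroup A) 1 : ℤ) + (bettiNumber (bottGroup A) 2 : ℤ) := by
  have hfg : Group.FG (bottGroup A) := bottTail_zero A ▸ inferInstanceAs (Group.FG (bottTail A 0))
  have h1 : Module.Finite ℤ (cohomZ (bottGroup A) 1) := finite_cohomZ_one _
  have h2 : Module.Finite ℤ (cohomZ (bottGroup A) 2) :=
    bottTail_zero A ▸ finite_cohomZ_two_bottTail hA n 0 (by simp)
  exact ⟨h1, h2, finrank_rhoImage_two _ (cohomZ_one_eq_zero_of_two_smul _)
    ((natCard_cohomF2_one_eq_hom _).trans (natCard_bottGroup_hom A))⟩
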